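/- Let $\mathcal G$ be a connected undirected graph on $m$ agents with Laplacian $\bar W\in\mathbb R^{m\times m}$, let $W=\bar W\otimes I_n$, and let $\chi(W)$ be the ratio of the largest to the smallest positive eigenvalue of $W$. Let $f_1,\dots,f_m:\mathbb R^n\to\mathbb R$ be convex, and let $F(x)=\sum_{i=1}^m f_i(x_i)$ for $x=(x_1,\dots,x_m)\in\mathbb R^{mn}$ be $M$-Lipschitz in the Euclidean norm. Consider the problem $$\min_{\sqrt W x=0}F(x).\qquad (P)$$ Let $x^*(0)\in\mathbb R^{mn}$ be a minimizer of $F$ over $\mathbb R^{mn}$, let $x^*$ be the solution of $(P)$ closest to $x^*(0)$, and assume $R_x=\|x^*-x^*(0)\|_2>0$. Let $\varepsilon>0$, $\mu=\varepsilon/R_x^2$, and $$F^\mu(x)=F(x)+\frac{\mu}{2}\|x-x^*(0)\|_2^2,\qquad \varphi(y)=\max_x\{\langle \sqrt W y,x\rangle-F^\mu(x)\}.$$ Let $y^*$ be the minimizer of $\varphi$ of smallest norm, $R=\|y^*\|_2$ and $\mu_\varphi=\varepsilon/R^2$. Suppose that $F$ is dual-friendly: each agent $j$ has access to the explicit solution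 $x_j^*(w)=\arg\max_{v\in\mathbb R^n}\{\langle w,v\rangle-f_j(v)-\frac{\mu}{2}\|v-x^*(0)_j\|_2^2\}$ for every $w\in\mathbb R^n$; write $x^*(z)=(x_1^*(z^1),\dots,x_m^*(z^m))$ for $z=(z^1,\dots,z^m)\in\mathbb R^{mn}$ (for $z=0$ this is the minimizer $x^*(0)$ above). Apply the distributed fast gradient method to the regularized dual function $\varphi(y)+\frac{\mu_\varphi}{2}\|y\|_2^2$, that is, put $z_0=\tilde z_0=0$ and $$z_{k+1}^i=\tilde z_k^i-\frac1L\Big(\sum_{j=1}^m\bar W_{ij}\,x_j^*(\tilde z_k^j)+\mu_\varphi\tilde z_k^i\Big),\qquad \tilde z_{k+1}^i=z_{k+1}^i+\frac{\sqrt{L}-\sqrt{\mu_\varphi}}{\sqrt{L}+\sqrt{\mu_\varphi}}\,(z_{k+1}^i-z_k^i),$$ where $L=\lambda_{\max}(W)/\mu+\mu_\varphi$. Then $R>0$, and after $$N=\tilde O\left(\sqrt{\frac{M^2R_x^2}{\varepsilon^2}\chi(W)}\right)$$ iterations the point $x^*(z_N)$ is an $(\varepsilon,\varepsilon/R)$-optimal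 solution of $(P)$, i.e. $F(x^*(z_N))-F(x^*)\le\varepsilon$ and $\|\sqrt W x^*(z_N)\|_2\le\varepsilon/R$. Precisely: there is a universal constant $C>0$ (independent of $m$, $n$, the graph, the functions, $M$ and $\varepsilon$) such that this holds for every integer $N\ge C\,T(1+\log T)$, where $$T=\sqrt{\frac{\max\{M,\varepsilon/R_x\}^2R_x^2}{\varepsilon^2}\chi(W)},$$ which is $\sqrt{M^2R_x^2\chi(W)/\varepsilon^2}$ whenever $\varepsilon\le MR_x$. -/

import Mathlib

open scoped NNReal RealInnerProductSpace

noncomputable section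

namespace DistOpt

/-- The space `ℝⁿ` of the decision variable of one agent (Euclidean norm). -/
abbrev Local (n : ℕ) : Type := EuclideanSpace ℝ (Fin n)

/-- The space `ℝ^{mn}` of stacked vectors `x = (x₁, …, x_m)` (Euclidean norm). -/
abbrev Stacked (m n : ℕ) : Type := EuclideanSpace ℝ (Fin m × Fin n)

/-- The block `x_i` that agent `i` holds. -/
def block {m n : ℕ} (x : Stacked m n) (i : Fin m) : Local n :=
  WithLp.toLp 2 fun k => x (i, k)

/-- The stacked vector with blocks `u i`. -/
def stack {m n : ℕ} (u : Fin m → Local n) : Stacked m n :=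
  WithLp.toLp 2 fun p => u p.1 p.2

/-- The separable objective `F(x) = ∑ i, f_i(x_i)`. -/
def total {m n : ℕ} (f : Fin m → Local n → ℝ) (x : Stacked m n) : ℝ :=
  ∑ i, f i (block x i)

/-- The communication matrix `W = W̄ ⊗ I_n`, with `W̄` the graph Laplacian. -/
def commMatrix {m : ℕ} (G : SimpleGraph (Fin m)) [DecidableRel G.Adj] (n : ℕ) :
    Matrix (Fin m × Fin n) (Fin m × Fin n) ℝ :=
  Matrix.kronecker (G.lapMatrix ℝ) (1 : Matrix (Fin n) (Fin n) ℝ)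

open scoped MatrixOrder in
/-- The positive semidefinite square root `√W`. -/
def sqrtComm {m : ℕ} (G : SimpleGraph (Fin m)) [DecidableRel G.Adj] (n : ℕ) :
    Matrix (Fin m × Fin n) (Fin m × Fin n) ℝ :=
  CFC.sqrt (commMatrix G n)

section Generic

variable {ι : Type} [Fintype ι] [DecidableEq ι]

/-- The product `A x` on Euclidean space. -/
def app (A : Matrix ι ι ℝ) (x : EuclideanSpace ℝ ι) : EuclideanSpace ℝ ι :=
  Matrix.toEuclideanLin A x

/-- `σ_max(A) = λ_max(AᵀA)`. -/
def sigmaMax (A : Matrix ι ι ℝ) : ℝ :=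
  sSup {l : ℝ | ∃ v : ι → ℝ, v ≠ 0 ∧ Matrix.mulVec (A.transpose * A) v = l • v}

/-- `σ_min(A)`: the smallest positive eigenvalue of `AᵀA`. -/
def sigmaMin (A : Matrix ι ι ℝ) : ℝ :=
  sInf {l : ℝ | 0 < l ∧ ∃ v : ι → ℝ, v ≠ 0 ∧ Matrix.mulVec (A.transpose * A) v = l • v}

/-- `χ(AᵀA) = σ_max(A) / σ_min(A)`. -/
def chi (A : Matrix ι ι ℝ) : ℝ := sigmaMax A / sigmaMin A

/-- `x` solves the dual subproblem `max_v ⟨z, v⟩ - g(v)`, i.e. `x = x^*(z)`. -/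
def IsSubSol (g : EuclideanSpace ℝ ι → ℝ) (z x : EuclideanSpace ℝ ι) : Prop :=
  IsMaxOn (fun v => ⟪z, v⟫ - g v) Set.univ x

/-- The regularized function `g^μ(x) = g(x) + (μ/2) ‖x - c‖²`. -/
def regularize (g : EuclideanSpace ℝ ι → ℝ) (μ : ℝ) (c : EuclideanSpace ℝ ι) :
    EuclideanSpace ℝ ι → ℝ :=
  fun x => g x + μ / 2 * ‖x - c‖ ^ 2

/-- The dual function `φ(y) = max_x ⟨Aᵀy, x⟩ - g(x)` of `min_{Ax = 0} g(x)`. -/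
def dualFun (A : Matrix ι ι ℝ) (g : EuclideanSpace ℝ ι → ℝ) (y : EuclideanSpace ℝ ι) : ℝ :=
  ⨆ x, (⟪app A.transpose y, x⟫ - g x)

/-- `y` minimizes `h`, and has the smallest norm among all minimizers. -/
def IsMinNormMinimizer (h : EuclideanSpace ℝ ι → ℝ) (y : EuclideanSpace ℝ ι) : Prop :=
  IsMinOn h Set.univ y ∧ ∀ y', IsMinOn h Set.univ y' → ‖y‖ ≤ ‖y'‖

/-- `x` solves the constrained problem `min_{Ax = 0} g(x)`. -/
def IsConstrainedSol (A : Matrix ι ι ℝ) (g : EuclideanSpace ℝ ι → ℝ)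
    (x : EuclideanSpace ℝ ι) : Prop :=
  app A x = 0 ∧ ∀ v, app A v = 0 → g x ≤ g v

/-- Among the solutions of `min_{Ax = 0} g(x)`, `x` is one closest to `c`. -/
def IsClosestSol (A : Matrix ι ι ℝ) (g : EuclideanSpace ℝ ι → ℝ)
    (c x : EuclideanSpace ℝ ι) : Prop :=
  IsConstrainedSol A g x ∧ ∀ x', IsConstrainedSol A g x' → ‖x - c‖ ≤ ‖x' - c‖

/-- `xhat` is `(ε, ε')`-optimal for `min_{Ax = 0} g(x)`: the value `g(xhat)` exceeds the optimal
value (hence the value at every feasible point) by at most `ε`, and `‖A xhat‖ ≤ ε'`. -/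
def IsApproxOptimal (A : Matrix ι ι ℝ) (g : EuclideanSpace ℝ ι → ℝ) (ε ε' : ℝ)
    (xhat : EuclideanSpace ℝ ι) : Prop :=
  (∀ v, app A v = 0 → g xhat - g v ≤ ε) ∧ ‖app A xhat‖ ≤ ε'

end Generic

/-- The distributed dual fast gradient method, started at `z₀ = z̃₀ = 0`; the pair is
`(z_k, z̃_k)`. Agent `j` answers with its part `xs j (z̃_k^j)` of the solution of the dual
subproblem. With `z = √W y` it is the fast gradient method on `φ(y) + (ν/2) ‖y‖²`: the term
`ν • z̃_k` comes from the regularizer, and `L`, `ν` are the smoothness and strong convexity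
constants of this function. -/
def distFGM {m n : ℕ} (G : SimpleGraph (Fin m)) [DecidableRel G.Adj]
    (xs : Fin m → Local n → Local n) (L ν : ℝ) :
    ℕ → (Fin m → Local n) × (Fin m → Local n)
  | 0 => (fun _ => 0, fun _ => 0)
  | k + 1 =>
    let z := (distFGM G xs L ν k).1
    let zt := (distFGM G xs L ν k).2
    let z' : Fin m → Local n := fun i =>
      zt i - (1 / L) • (∑ j, G.lapMatrix ℝ i j • xs j (zt j) + ν • zt i)
    (z', fun i => z' i + ((√L - √ν) / (√L + √ν)) • (z' i - z i))

end DistOpt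

end

/-! Put `A = √W`. The function `F^μ` is `μ`-strongly convex, so `φ` is `λ_max(W)/μ`-smooth with
gradient `A x^*(A y)`. In the variable `z = A y` the distributed scheme is therefore accelerated
gradient descent on `φ + ν/2 ‖·‖²`, which converges linearly at rate `1 - s` with `s = √(ν/L)`
(`fgm_rate`).

Accuracy: the regularized minimizer `w` satisfies `∇φ(w) = -ν w` and is shorter than `y^*` by a
relative margin of order `ν/L`. Once the iterate `y` is close enough to `w`, this margin absorbs the
error, so that `‖∇φ(y)‖ ≤ ν R = ε/R`, and `⟪y, ∇φ(y)⟫ ≤ ν R²/2 = ε/2` (`fgm_regularized_gradient`).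
The first bound is the feasibility claim. The second, added to the bias `μ/2 R_x² = ε/2` of the
primal regularization, gives the gap `ε` (`primal_gap_le`).

Complexity: `A y^*` is a subgradient of a regularized Lipschitz function at a feasible point, which
gives `‖A y^*‖ ≤ M + ε/R_x`. The shortest `y^*` is orthogonal to `ker A`, so `R² ≤ 4 max(M,
ε/R_x)²/σ_min(A)`. Hence `L/ν ≤ 5 T²`, and closeness to `w` polynomial in `L/ν` costs `O(T (1 + log
T))` steps. -/

namespace DistOpt

/-! ### Accelerated gradient descent and Tikhonov regularization in an inner product space. -/

section Abstract

variable {E : Type*} [NormedAddCommGroup E] [InnerProductSpace ℝ E]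

/-- The fast gradient method with constant momentum `β` and step `1 / L`, started at `0`; the
pair consists of the iterate and the extrapolated point. -/
noncomputable def fgm (g : E → E) (L β : ℝ) : ℕ → E × E
  | 0 => (0, 0)
  | k + 1 =>
    let y' := (fgm g L β k).2 - (1 / L) • g (fgm g L β k).2
    (y', y' + β • (y' - (fgm g L β k).1))

theorem fgm_zero (g : E → E) (L β : ℝ) : fgm g L β 0 = (0, 0) := rfl

theorem fgm_succ_fst (g : E → E) (L β : ℝ) (k : ℕ) :
    (fgm g L β (k + 1)).1 = (fgm g L β k).2 - (1 / L) • g (fgm g L β k).2 := rfl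

theorem fgm_succ_snd (g : E → E) (L β : ℝ) (k : ℕ) :
    (fgm g L β (k + 1)).2 =
      (fgm g L β (k + 1)).1 + β • ((fgm g L β (k + 1)).1 - (fgm g L β k).1) := rfl

/-- A gradient step of length `1 / L` decreases an `L`-smooth function. -/
theorem gradient_step_le {Φ : E → ℝ} {g : E → E} {L : ℝ} (hL : 0 < L)
    (hup : ∀ x y, Φ y ≤ Φ x + ⟪g x, y - x⟫ + L / 2 * ‖y - x‖ ^ 2) (x : E) :
    Φ (x - (1 / L) • g x) ≤ Φ x - 1 / (2 * L) * ‖g x‖ ^ 2 := by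
  have h := hup x (x - (1 / L) • g x)
  have e : x - (1 / L) • g x - x = -((1 / L) • g x) := by abel
  rw [e, inner_neg_right, norm_neg, norm_smul, real_inner_smul_right,
    real_inner_self_eq_norm_sq, mul_pow, Real.norm_eq_abs, sq_abs] at h
  calc _ ≤ _ := h
    _ = _ := by field_simp; ring

/-- One step of the estimate for the fast gradient method, in terms of the distances
`p` to the previous iterate and `d` to the comparison point. -/
theorem fgm_lyapunov_identity (p d g : E) {s ν L : ℝ} (hs : 0 < s) (hν : 0 < ν)
    (hL : s ^ 2 * L = ν) (hLpos : 0 < L) :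
    ν / 2 * ‖d + ((1 - s) / s) • p - (1 / (s * L)) • g‖ ^ 2
      = (1 - s) * (ν / 2 * ‖d + (1 / s) • p‖ ^ 2) + s * (ν / 2 * ‖d‖ ^ 2)
        - s * (1 - s) * (ν / 2 * ‖(1 / s) • p‖ ^ 2)
        - s * ⟪g, d⟫ - (1 - s) * ⟪g, p⟫ + 1 / (2 * L) * ‖g‖ ^ 2 := by
  simp only [← real_inner_self_eq_norm_sq, inner_add_left, inner_add_right, inner_sub_left,
    inner_sub_right, real_inner_smul_left, real_inner_smul_right]
  rw [real_inner_comm d p, real_inner_comm g d, real_inner_comm g p]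
  subst hL
  field_simp
  ring

/-- The potential adds to the function gap the squared distance from `u` to the auxiliary point
`it.2 + (1/s)(it.2 - it.1)`. It contracts by `1 - s` at each step: weight the lower bound at the
previous iterate by `1 - s` and the strong convexity bound at `u` by `s`. The gradient step then
cancels the leftover `‖g‖²/(2L)`. -/
theorem fgm_rate {Φ : E → ℝ} {g : E → E} {L ν s : ℝ} (hν : 0 < ν) (hs : 0 < s) (hs1 : s ≤ 1)
    (hL : s ^ 2 * L = ν)
    (hlow : ∀ x y, Φ x + ⟪g x, y - x⟫ + ν / 2 * ‖y - x‖ ^ 2 ≤ Φ y)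
    (hup : ∀ x y, Φ y ≤ Φ x + ⟪g x, y - x⟫ + L / 2 * ‖y - x‖ ^ 2) (u : E) (k : ℕ) :
    let it := fgm g L ((1 - s) / (1 + s)) k
    Φ it.1 - Φ u + ν / 2 * ‖(it.2 - u) + (1 / s) • (it.2 - it.1)‖ ^ 2
      ≤ (1 - s) ^ k * (Φ 0 - Φ u + ν / 2 * ‖u‖ ^ 2) := by
  have hLpos : 0 < L := by
    by_contra h
    nlinarith [sq_nonneg s]
  induction k with
  | zero => simp [fgm_zero]
  | succ k ih =>
    simp only at ih ⊢
    set β := (1 - s) / (1 + s) with hβ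
    set y := (fgm g L β k).1 with hy
    set w := (fgm g L β k).2 with hw
    have e1 : (fgm g L β (k + 1)).1 = w - (1 / L) • g w := rfl
    have e2 : (fgm g L β (k + 1)).2 - u + (1 / s) • ((fgm g L β (k + 1)).2
        - (fgm g L β (k + 1)).1)
        = (w - u) + ((1 - s) / s) • (w - y) - (1 / (s * L)) • g w := by
      rw [fgm_succ_snd, e1, ← hy, hβ]
      match_scalars <;> field_simp <;> ring
    rw [e2, e1, fgm_lyapunov_identity (w - y) (w - u) (g w) hs hν hL hLpos]
    have h1 := gradient_step_le hLpos hup w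
    have h2 := hlow w y
    have h3 := hlow w u
    have n1 : ‖u - w‖ = ‖w - u‖ := norm_sub_rev _ _
    have i1 : ⟪g w, u - w⟫ = -⟪g w, w - u⟫ := by rw [← inner_neg_right]; congr 1; abel
    have i2 : ⟪g w, y - w⟫ = -⟪g w, w - y⟫ := by rw [← inner_neg_right]; congr 1; abel
    rw [n1, i1] at h3
    rw [i2] at h2
    have h2' : Φ w - ⟪g w, w - y⟫ ≤ Φ y := by
      have : 0 ≤ ν / 2 * ‖y - w‖ ^ 2 := by positivity
      linarith
    have h4 := mul_le_mul_of_nonneg_left ih (sub_nonneg.2 hs1)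
    have h5 := mul_le_mul_of_nonneg_left h2' (sub_nonneg.2 hs1)
    have h6 := mul_le_mul_of_nonneg_left h3 hs.le
    have h7 : 0 ≤ s * (1 - s) * (ν / 2 * ‖(1 / s) • (w - y)‖ ^ 2) :=
      mul_nonneg (mul_nonneg hs.le (sub_nonneg.2 hs1)) (by positivity)
    rw [pow_succ' (1 - s) k]
    linarith

/-- A minimizer of the sum of a convex function and `μ / 2 * ‖· - c‖ ^ 2` minus a linear form
satisfies the quadratic growth bound. -/
theorem quadratic_growth_of_isMaxOn {F : E → ℝ} (hF : ConvexOn ℝ Set.univ F) {μ : ℝ} {c z x : E}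
    (hx : IsMaxOn (fun v => ⟪z, v⟫ - (F v + μ / 2 * ‖v - c‖ ^ 2)) Set.univ x) (v : E) :
    F x + μ / 2 * ‖x - c‖ ^ 2 + ⟪z, v - x⟫ + μ / 2 * ‖v - x‖ ^ 2 ≤ F v + μ / 2 * ‖v - c‖ ^ 2 := by
  -- Compare `x` with the point `(1 - t) x + t v` of the segment, divide by `t`, and let `t → 0`.
  have key : ∀ t : ℝ, 0 < t → t < 1 →
      F x + μ / 2 * ‖x - c‖ ^ 2 + ⟪z, v - x⟫ + (1 - t) * (μ / 2 * ‖v - x‖ ^ 2)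
        ≤ F v + μ / 2 * ‖v - c‖ ^ 2 := by
    intro t ht ht1
    have h1 := hx (Set.mem_univ ((1 - t) • x + t • v))
    simp only [Set.mem_ofPred_eq] at h1
    have h2 := hF.2 (Set.mem_univ x) (Set.mem_univ v) (sub_nonneg.2 ht1.le) ht.le (by ring)
    simp only [smul_eq_mul] at h2
    have e : ‖(1 - t) • x + t • v - c‖ ^ 2
        = (1 - t) * ‖x - c‖ ^ 2 + t * ‖v - c‖ ^ 2 - t * (1 - t) * ‖v - x‖ ^ 2 := by
      have e1 : (1 - t) • x + t • v - c = (1 - t) • (x - c) + t • (v - c) := by module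
      have e2 : v - x = (v - c) - (x - c) := by abel
      rw [e1, e2]
      simp only [← real_inner_self_eq_norm_sq, inner_add_left, inner_add_right, inner_sub_left,
        inner_sub_right, real_inner_smul_left, real_inner_smul_right]
      ring
    have e3 : ⟪z, (1 - t) • x + t • v⟫ = ⟪z, x⟫ + t * ⟪z, v - x⟫ := by
      simp only [inner_add_right, inner_sub_right, real_inner_smul_right]; ring
    rw [e, e3] at h1
    have : t * (F x + μ / 2 * ‖x - c‖ ^ 2 + ⟪z, v - x⟫ + (1 - t) * (μ / 2 * ‖v - x‖ ^ 2))
        ≤ t * (F v + μ / 2 * ‖v - c‖ ^ 2) := by linarith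
    exact le_of_mul_le_mul_left this ht
  have hlim : Filter.Tendsto (fun t : ℝ => F x + μ / 2 * ‖x - c‖ ^ 2 + ⟪z, v - x⟫
      + (1 - t) * (μ / 2 * ‖v - x‖ ^ 2)) (nhdsWithin 0 (Set.Ioi 0))
      (nhds (F x + μ / 2 * ‖x - c‖ ^ 2 + ⟪z, v - x⟫ + (1 - 0) * (μ / 2 * ‖v - x‖ ^ 2))) := by
    apply Filter.Tendsto.mono_left _ nhdsWithin_le_nhds
    exact Continuous.tendsto (by fun_prop) 0
  rw [sub_zero, one_mul] at hlim
  refine le_of_tendsto hlim ?_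
  filter_upwards [Ioo_mem_nhdsGT (zero_lt_one' ℝ)] with t ht using key t ht.1 ht.2

/-- A function between a linear and a quadratic bound at every point is continuous. -/
theorem continuous_of_bounds {φ : E → ℝ} {g : E → E} {L : ℝ}
    (hlow : ∀ x y, φ x + ⟪g x, y - x⟫ ≤ φ y)
    (hup : ∀ x y, φ y ≤ φ x + ⟪g x, y - x⟫ + L / 2 * ‖y - x‖ ^ 2) : Continuous φ := by
  rw [continuous_iff_continuousAt]
  intro x
  have h1 : Filter.Tendsto (fun y => φ x + ⟪g x, y - x⟫) (nhds x) (nhds (φ x)) := by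
    have : Continuous (fun y => φ x + ⟪g x, y - x⟫) := by fun_prop
    simpa using this.tendsto x
  have h2 : Filter.Tendsto (fun y => φ x + ⟪g x, y - x⟫ + L / 2 * ‖y - x‖ ^ 2) (nhds x)
      (nhds (φ x)) := by
    have : Continuous (fun y => φ x + ⟪g x, y - x⟫ + L / 2 * ‖y - x‖ ^ 2) := by fun_prop
    simpa using this.tendsto x
  exact tendsto_of_tendsto_of_tendsto_of_le_of_le h1 h2 (hlow x) (hup x)

/-- Tikhonov regularization of a smooth convex function with a minimizer `u`: the regularized
function has a minimizer `w`, at which `g w = -ν w`, and which is strictly shorter than `u`. -/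
theorem exists_regularized_minimizer [FiniteDimensional ℝ E] {φ : E → ℝ} {g : E → E} {l ν : ℝ}
    (hl : 0 < l) (hν : 0 < ν) (hlow : ∀ x y, φ x + ⟪g x, y - x⟫ ≤ φ y)
    (hup : ∀ x y, φ y ≤ φ x + ⟪g x, y - x⟫ + l / 2 * ‖y - x‖ ^ 2)
    {u : E} (hu : ∀ y, φ u ≤ φ y) :
    ∃ w, g w = -(ν • w) ∧ (l + ν) * ‖w‖ ^ 2 ≤ l * ‖u‖ ^ 2 := by
  have hcont := continuous_of_bounds hlow hup
  obtain ⟨w, hw⟩ : ∃ w, ∀ y, φ w + ν / 2 * ‖w‖ ^ 2 ≤ φ y + ν / 2 * ‖y‖ ^ 2 := by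
    have hc : Continuous (fun y => φ y + ν / 2 * ‖y‖ ^ 2) := by fun_prop
    refine hc.exists_forall_le ?_
    have : Filter.Tendsto (fun y : E => φ u + ν / 2 * ‖y‖ ^ 2) (Filter.cocompact E)
        Filter.atTop := by
      apply Filter.tendsto_atTop_add_const_left
      apply Filter.Tendsto.const_mul_atTop (by positivity)
      exact (Filter.tendsto_pow_atTop two_ne_zero).comp (tendsto_norm_cocompact_atTop)
    exact Filter.tendsto_atTop_mono (fun y => by have := hu y; linarith) this
  have hup' : ∀ x y, φ y + ν / 2 * ‖y‖ ^ 2 ≤ (φ x + ν / 2 * ‖x‖ ^ 2) + ⟪g x + ν • x, y - x⟫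
      + (l + ν) / 2 * ‖y - x‖ ^ 2 := by
    intro x y
    have h := hup x y
    have e : ‖y‖ ^ 2 = ‖x‖ ^ 2 + 2 * ⟪x, y - x⟫ + ‖y - x‖ ^ 2 := by
      rw [← norm_add_sq_real]; congr 2; abel
    rw [e, inner_add_left, real_inner_smul_left]
    linarith
  have h0 : g w + ν • w = 0 := by
    have h1 := gradient_step_le (Φ := fun y => φ y + ν / 2 * ‖y‖ ^ 2)
      (g := fun x => g x + ν • x) (by positivity : 0 < l + ν) hup' w
    have h2 := hw (w - (1 / (l + ν)) • (g w + ν • w))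
    have h3 : 1 / (2 * (l + ν)) * ‖g w + ν • w‖ ^ 2 ≤ 0 := by linarith
    have h4 : 0 < 1 / (2 * (l + ν)) := by positivity
    have h5 : ‖g w + ν • w‖ ^ 2 ≤ 0 := by
      by_contra h
      push Not at h
      linarith [mul_pos h4 h]
    simpa using pow_eq_zero_iff (two_ne_zero) |>.1 (le_antisymm h5 (sq_nonneg _))
  have hg : g w = -(ν • w) := eq_neg_of_add_eq_zero_left h0
  refine ⟨w, hg, ?_⟩
  -- A gradient step for `φ` itself from `w` cannot go below `φ u`, so `φ w - φ u ≥ ν² ‖w‖²/(2l)`.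
  -- Together with optimality of `w` against `u` this gives the factor `l/(l + ν)`.
  have h1 := gradient_step_le hl hup w
  have h2 := hu (w - (1 / l) • g w)
  have h3 := hw u
  have e : ‖g w‖ ^ 2 = ν ^ 2 * ‖w‖ ^ 2 := by
    rw [hg, norm_neg, norm_smul, mul_pow, Real.norm_eq_abs, sq_abs]
  rw [e] at h1
  have h4 : ν ^ 2 * ‖w‖ ^ 2 / (2 * l) + ν / 2 * ‖w‖ ^ 2 ≤ ν / 2 * ‖u‖ ^ 2 := by
    have : 1 / (2 * l) * (ν ^ 2 * ‖w‖ ^ 2) = ν ^ 2 * ‖w‖ ^ 2 / (2 * l) := by ring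
    linarith
  have h5 : ν / (2 * l) * ((l + ν) * ‖w‖ ^ 2) ≤ ν / (2 * l) * (l * ‖u‖ ^ 2) := by
    calc _ = ν ^ 2 * ‖w‖ ^ 2 / (2 * l) + ν / 2 * ‖w‖ ^ 2 := by field_simp; ring
      _ ≤ _ := h4
      _ = _ := by field_simp
  exact le_of_mul_le_mul_left h5 (by positivity)

/-- The fast gradient method for the regularized function: if `(1 - s) ^ N` is polynomially small
in the condition number `κ = L / ν`, then at the last iterate the gradient of the original
function is at most `ν ‖u‖`, and its inner product with the iterate is at most `ν ‖u‖² / 2`. -/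
theorem fgm_regularized_gradient [FiniteDimensional ℝ E] {φ : E → ℝ} {g : E → E} {l ν s κ : ℝ}
    (hl : 0 < l) (hν : 0 < ν) (hlow : ∀ x y, φ x + ⟪g x, y - x⟫ ≤ φ y)
    (hup : ∀ x y, φ y ≤ φ x + ⟪g x, y - x⟫ + l / 2 * ‖y - x‖ ^ 2)
    (hlip : ∀ x y, ‖g x - g y‖ ≤ l * ‖x - y‖)
    {u : E} (hu : ∀ y, φ u ≤ φ y) (hs : 0 < s) (hs1 : s ≤ 1) (hsκ : s ^ 2 * κ = 1)
    (hκ : l + ν = κ * ν) (N : ℕ) (hN : (1 - s) ^ N * (128 * κ ^ 5) ≤ 1) :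
    let y := (fgm (fun y => g y + ν • y) (l + ν) ((1 - s) / (1 + s)) N).1
    ‖g y‖ ≤ ν * ‖u‖ ∧ ⟪y, g y⟫ ≤ ν * ‖u‖ ^ 2 / 2 := by
  intro y
  obtain ⟨w, hgw, hwu⟩ := exists_regularized_minimizer hl hν hlow hup hu
  set R := ‖u‖ with hR
  have hR0 : 0 ≤ R := norm_nonneg _
  have hκ1 : 1 < κ := by
    by_contra h
    nlinarith
  have hκ0 : 0 < κ := by linarith
  have hlν : l = (κ - 1) * ν := by linarith
  -- This is `√(1 - 1/κ) ≤ 1 - 1/(2κ)`; the slack `R/(2κ)` pays for stopping before `w` is reached.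
  have hw : ‖w‖ ≤ R - R / (2 * κ) := by
    have hR' : 0 ≤ R - R / (2 * κ) := by
      rw [sub_nonneg]; exact div_le_self hR0 (by linarith)
    apply le_of_sq_le_sq _ hR'
    have h1 : κ * ‖w‖ ^ 2 ≤ (κ - 1) * R ^ 2 := by
      rw [hκ, hlν] at hwu
      refine le_of_mul_le_mul_left ?_ hν
      linarith
    have h2 : ‖w‖ ^ 2 ≤ (κ - 1) * R ^ 2 / κ := by rw [le_div_iff₀ hκ0]; linarith
    refine h2.trans ?_
    have e : (R - R / (2 * κ)) ^ 2 - (κ - 1) * R ^ 2 / κ = (R / (2 * κ)) ^ 2 := by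
      field_simp; ring
    linarith [sq_nonneg (R / (2 * κ))]
  have hwR : ‖w‖ ≤ R := hw.trans (sub_le_self _ (by positivity))
  -- distance of the last iterate to the regularized minimizer
  set Φ : E → ℝ := fun y => φ y + ν / 2 * ‖y‖ ^ 2 with hΦ
  have e : ∀ x y : E, ‖y‖ ^ 2 = ‖x‖ ^ 2 + 2 * ⟪x, y - x⟫ + ‖y - x‖ ^ 2 := by
    intro x y; rw [← norm_add_sq_real]; congr 2; abel
  have hΦlow : ∀ x y, Φ x + ⟪g x + ν • x, y - x⟫ + ν / 2 * ‖y - x‖ ^ 2 ≤ Φ y := by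
    intro x y
    simp only [hΦ]
    rw [e x y, inner_add_left, real_inner_smul_left]
    linarith [hlow x y]
  have hΦup : ∀ x y, Φ y ≤ Φ x + ⟪g x + ν • x, y - x⟫ + (l + ν) / 2 * ‖y - x‖ ^ 2 := by
    intro x y
    simp only [hΦ]
    rw [e x y, inner_add_left, real_inner_smul_left]
    linarith [hup x y]
  have hsL : s ^ 2 * (l + ν) = ν := by rw [hκ, ← mul_assoc, hsκ, one_mul]
  have hgw0 : g w + ν • w = 0 := by rw [hgw]; abel
  have hrate := fgm_rate hν hs hs1 hsL hΦlow hΦup w N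
  have hD1 : ν / 2 * ‖y - w‖ ^ 2 ≤ (1 - s) ^ N * (κ * ν * R ^ 2) := by
    have h1 := hΦlow w y
    have h2 := hΦup w 0
    rw [hgw0, inner_zero_left] at h1 h2
    rw [zero_sub, norm_neg] at h2
    have h3 : Φ 0 - Φ w + ν / 2 * ‖w‖ ^ 2 ≤ κ * ν * R ^ 2 := by
      have : ‖w‖ ^ 2 ≤ R ^ 2 := pow_le_pow_left₀ (norm_nonneg _) hwR 2
      rw [hκ] at h2
      have h4 : κ * ν / 2 * ‖w‖ ^ 2 ≤ κ * ν / 2 * R ^ 2 := by gcongr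
      have h5 : ν / 2 * ‖w‖ ^ 2 ≤ κ * ν / 2 * R ^ 2 := by
        calc ν / 2 * ‖w‖ ^ 2 ≤ ν / 2 * R ^ 2 := by gcongr
          _ = 1 * (ν / 2 * R ^ 2) := (one_mul _).symm
          _ ≤ κ * (ν / 2 * R ^ 2) := by gcongr
          _ = _ := by ring
      linarith
    have h4 := mul_le_mul_of_nonneg_left h3 (pow_nonneg (sub_nonneg.2 hs1) N)
    simp only at hrate
    have h5 : 0 ≤ ν / 2 * ‖((fgm (fun y => g y + ν • y) (l + ν) ((1 - s) / (1 + s)) N).2 - w)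
      + (1 / s) • ((fgm (fun y => g y + ν • y) (l + ν) ((1 - s) / (1 + s)) N).2
        - (fgm (fun y => g y + ν • y) (l + ν) ((1 - s) / (1 + s)) N).1)‖ ^ 2 := by positivity
    have h6 : Φ y = Φ (fgm (fun y => g y + ν • y) (l + ν) ((1 - s) / (1 + s)) N).1 := rfl
    linarith
  -- The square of this radius is `R²/(64κ⁴)`, and the rate leaves a factor `2κ`: hence `128κ⁵`. One
  -- `κ` is then lost to the Lipschitz constant `l ≤ κν`.
  have hD : ‖y - w‖ ≤ R / (8 * κ ^ 2) := by
    apply le_of_sq_le_sq _ (by positivity)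
    have h1 : ‖y - w‖ ^ 2 ≤ (1 - s) ^ N * (2 * κ * R ^ 2) := by
      refine le_of_mul_le_mul_left ?_ (half_pos hν)
      linarith
    refine h1.trans ?_
    rw [div_pow, le_div_iff₀ (by positivity)]
    calc _ = ((1 - s) ^ N * (128 * κ ^ 5)) * R ^ 2 := by ring
      _ ≤ 1 * R ^ 2 := by gcongr
      _ = _ := one_mul _
  have hlD : l * ‖y - w‖ ≤ ν * (R / (8 * κ)) := by
    calc l * ‖y - w‖ ≤ (κ * ν) * (R / (8 * κ ^ 2)) := by
          gcongr; linarith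
      _ = _ := by field_simp
  have hdiff : ‖g y - g w‖ ≤ ν * (R / (8 * κ)) := (hlip y w).trans hlD
  constructor
  · have h1 : ‖g y‖ ≤ ‖g y - g w‖ + ‖g w‖ := by
      simpa using norm_add_le (g y - g w) (g w)
    have h2 : ‖g w‖ = ν * ‖w‖ := by
      rw [hgw, norm_neg, norm_smul, Real.norm_of_nonneg hν.le]
    have h3 : ν * ‖w‖ ≤ ν * (R - R / (2 * κ)) := by gcongr
    have h4 : ν * (R / (8 * κ)) ≤ ν * (R / (2 * κ)) := by gcongr; norm_num
    linarith
  -- The errors total `(9/64 + 1/8) ν R² < ν R²/2`, and `-ν ‖w‖²` has the favourable sign.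
  · have h1 : ⟪y, g y⟫ = ⟪y, g y - g w⟫ - ν * ⟪y - w, w⟫ - ν * ‖w‖ ^ 2 := by
      rw [hgw, ← real_inner_self_eq_norm_sq]
      simp only [inner_sub_right, inner_sub_left, inner_neg_right, real_inner_smul_right]
      ring
    have hb : R / (8 * κ) ≤ R / 8 := by gcongr; linarith
    have hb2 : R / (8 * κ ^ 2) ≤ R / 8 := by gcongr; nlinarith
    have h2 : ⟪y, g y - g w⟫ ≤ (9 / 8 * R) * (ν * (R / 8)) := by
      refine (real_inner_le_norm _ _).trans ?_
      have hy : ‖y‖ ≤ 9 / 8 * R := by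
        have : ‖y‖ ≤ ‖y - w‖ + ‖w‖ := by simpa using norm_add_le (y - w) w
        linarith
      gcongr
      exact hdiff.trans (by gcongr)
    have h3 : -(ν * ⟪y - w, w⟫) ≤ ν * (R / 8 * R) := by
      rw [← mul_neg, ← inner_neg_right]
      gcongr
      refine (real_inner_le_norm _ _).trans ?_
      rw [norm_neg]
      gcongr
      exact hD.trans hb2
    have h4 : 0 ≤ ν * ‖w‖ ^ 2 := by positivity
    have h5 : 0 ≤ ν * R ^ 2 := by positivity
    nlinarith

end Abstract

end DistOpt

namespace DistOpt

/-! ### The dual function: smoothness, dual solutions, and recovery of primal points. -/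

section Dual

variable {E : Type*} [NormedAddCommGroup E] [InnerProductSpace ℝ E]

/-- If `X z` maximizes `⟪z, ·⟫ - H`, this is the value at `y` of the dual function
`max_x ⟪A y, x⟫ - H x`. -/
noncomputable def dualValue (A : E →ₗ[ℝ] E) (H : E → ℝ) (X : E → E) (y : E) : ℝ :=
  ⟪A y, X (A y)⟫ - H (X (A y))

variable {A : E →ₗ[ℝ] E} {H : E → ℝ} {X : E → E} {μ Λ : ℝ}

/-- The dual function is a supremum of affine functions of `y`; testing it with `X (A x)` gives the
affine minorant that is exact at `x`. -/
theorem dualValue_lower (hA : A.IsSymmetric) (hμ : 0 < μ)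
    (hX : ∀ z v, H (X z) + ⟪z, v - X z⟫ + μ / 2 * ‖v - X z‖ ^ 2 ≤ H v) (x y : E) :
    dualValue A H X x + ⟪A (X (A x)), y - x⟫ ≤ dualValue A H X y := by
  have h := hX (A y) (X (A x))
  have h1 : 0 ≤ μ / 2 * ‖X (A x) - X (A y)‖ ^ 2 := by positivity
  rw [hA, map_sub, inner_sub_right, real_inner_comm (A y), real_inner_comm (A x)]
  rw [inner_sub_right] at h
  unfold dualValue
  linarith

/-- Strong convexity is dual to smoothness: quadratic growth at `X (A x)`, tested at `X (A y)`,
absorbs the cross term by Young's inequality. -/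
theorem dualValue_upper (hA : A.IsSymmetric) (hμ : 0 < μ) (hΛ : ∀ x, ‖A x‖ ^ 2 ≤ Λ * ‖x‖ ^ 2)
    (hX : ∀ z v, H (X z) + ⟪z, v - X z⟫ + μ / 2 * ‖v - X z‖ ^ 2 ≤ H v) (x y : E) :
    dualValue A H X y ≤
      dualValue A H X x + ⟪A (X (A x)), y - x⟫ + Λ / μ / 2 * ‖y - x‖ ^ 2 := by
  have h := hX (A x) (X (A y))
  set d := X (A y) - X (A x) with hd
  have h1 : ⟪A (y - x), d⟫ ≤ μ / 2 * ‖d‖ ^ 2 + 1 / (2 * μ) * ‖A (y - x)‖ ^ 2 := by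
    refine (real_inner_le_norm _ _).trans ?_
    have : μ / 2 * ‖d‖ ^ 2 + 1 / (2 * μ) * ‖A (y - x)‖ ^ 2 - ‖A (y - x)‖ * ‖d‖
        = (μ * ‖d‖ - ‖A (y - x)‖) ^ 2 / (2 * μ) := by field_simp; ring
    have : 0 ≤ (μ * ‖d‖ - ‖A (y - x)‖) ^ 2 / (2 * μ) := by positivity
    linarith
  have h2 : 1 / (2 * μ) * ‖A (y - x)‖ ^ 2 ≤ Λ / μ / 2 * ‖y - x‖ ^ 2 := by
    calc _ ≤ 1 / (2 * μ) * (Λ * ‖y - x‖ ^ 2) := by gcongr; exact hΛ _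
      _ = _ := by field_simp
  have h3 : ⟪A y, X (A y)⟫ = ⟪A x, X (A x)⟫ + ⟪A x, d⟫ + ⟪A (X (A x)), y - x⟫
      + ⟪A (y - x), d⟫ := by
    have e1 : ⟪A (X (A x)), y - x⟫ = ⟪A (y - x), X (A x)⟫ := by rw [hA, real_inner_comm]
    rw [e1, hd, map_sub]
    simp only [inner_sub_right, inner_sub_left]
    ring
  unfold dualValue
  linarith

/-- Adding the growth bounds at the two points shows that `X` is `1/μ`-Lipschitz; each of the two
applications of `A` costs `√Λ`. -/
theorem dual_gradient_lipschitz (hμ : 0 < μ) (hΛ0 : 0 ≤ Λ)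
    (hΛ : ∀ x, ‖A x‖ ^ 2 ≤ Λ * ‖x‖ ^ 2)
    (hX : ∀ z v, H (X z) + ⟪z, v - X z⟫ + μ / 2 * ‖v - X z‖ ^ 2 ≤ H v) (x y : E) :
    ‖A (X (A x)) - A (X (A y))‖ ≤ Λ / μ * ‖x - y‖ := by
  set d := X (A x) - X (A y) with hd
  have h1 : μ * ‖d‖ ≤ ‖A (x - y)‖ := by
    have ha := hX (A x) (X (A y))
    have hb := hX (A y) (X (A x))
    rw [norm_sub_rev, ← hd] at ha
    rw [← hd] at hb
    have e : ⟪A x, X (A y) - X (A x)⟫ = -⟪A x, d⟫ := by rw [← inner_neg_right, hd, neg_sub]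
    have hc : μ * ‖d‖ ^ 2 ≤ ⟪A (x - y), d⟫ := by
      rw [map_sub, inner_sub_left]; linarith
    have hd' := hc.trans (real_inner_le_norm _ _)
    rcases (norm_nonneg d).eq_or_lt with h0 | h0
    · rw [← h0]; simp
    · refine le_of_mul_le_mul_right ?_ h0
      linarith
  rw [← map_sub, ← hd]
  apply le_of_sq_le_sq _ (by positivity)
  calc ‖A d‖ ^ 2 ≤ Λ * ‖d‖ ^ 2 := hΛ d
    _ = Λ / μ ^ 2 * (μ * ‖d‖) ^ 2 := by field_simp
    _ ≤ Λ / μ ^ 2 * ‖A (x - y)‖ ^ 2 := by gcongr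
    _ ≤ Λ / μ ^ 2 * (Λ * ‖x - y‖ ^ 2) := by gcongr; exact hΛ _
    _ = _ := by field_simp

/-- At a minimizer of the dual function the primal point is feasible. -/
theorem map_eq_zero_of_dual_minimizer (hA : A.IsSymmetric) (hμ : 0 < μ) (hΛpos : 0 < Λ)
    (hΛ : ∀ x, ‖A x‖ ^ 2 ≤ Λ * ‖x‖ ^ 2)
    (hX : ∀ z v, H (X z) + ⟪z, v - X z⟫ + μ / 2 * ‖v - X z‖ ^ 2 ≤ H v)
    {u : E} (hu : ∀ y, dualValue A H X u ≤ dualValue A H X y) : A (X (A u)) = 0 := by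
  have hl : 0 < Λ / μ := by positivity
  have h1 := gradient_step_le hl (dualValue_upper hA hμ hΛ hX) u
  have h2 := hu (u - (1 / (Λ / μ)) • A (X (A u)))
  by_contra h
  have h3 : 0 < 1 / (2 * (Λ / μ)) * ‖A (X (A u))‖ ^ 2 := by
    have : 0 < ‖A (X (A u))‖ := norm_pos_iff.2 h
    positivity
  linarith

/-- The image of a dual solution is a subgradient of the regularized objective, hence bounded. -/
theorem norm_map_dual_minimizer_le (hA : A.IsSymmetric) {F : E → ℝ} {M : ℝ≥0}
    (hF : LipschitzWith M F) (hμ : 0 < μ) {c x : E}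
    (hX : ∀ z v, F (X z) + μ / 2 * ‖X z - c‖ ^ 2 + ⟪z, v - X z⟫ + μ / 2 * ‖v - X z‖ ^ 2
      ≤ F v + μ / 2 * ‖v - c‖ ^ 2)
    (hx : A x = 0) (hxF : ∀ v, A v = 0 → F x ≤ F v) {u : E} (hu : A (X (A u)) = 0) :
    ‖A u‖ ≤ M + μ * ‖x - c‖ := by
  set p := X (A u) with hp
  -- Both `p` and `x` are feasible, so the linear term `⟪A u, x - p⟫` vanishes.
  have h1 : ‖p - c‖ ≤ ‖x - c‖ := by
    have h := hX (A u) x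
    rw [← hp, hA, map_sub, hx, hu, sub_zero, inner_zero_right] at h
    have h2 := hxF p hu
    have h3 : 0 ≤ μ / 2 * ‖x - p‖ ^ 2 := by positivity
    apply le_of_sq_le_sq _ (norm_nonneg _)
    refine le_of_mul_le_mul_left ?_ (half_pos hμ)
    linarith
  -- Moving along `A u` itself turns the linear term into `‖A u‖²`, and the two terms `μ/2 ‖A u‖²`
  -- cancel.
  have h2 := hX (A u) (p + A u)
  rw [← hp, add_sub_cancel_left, real_inner_self_eq_norm_sq, add_sub_right_comm,
    norm_add_sq_real] at h2
  have h3 : F (p + A u) - F p ≤ M * ‖A u‖ := by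
    have := hF.dist_le_mul (p + A u) p
    rw [dist_self_add_left, Real.dist_eq] at this
    exact (le_abs_self _).trans this
  have h4 : ⟪p - c, A u⟫ ≤ ‖x - c‖ * ‖A u‖ :=
    (real_inner_le_norm _ _).trans (by gcongr)
  have h5 : μ * ⟪p - c, A u⟫ ≤ μ * (‖x - c‖ * ‖A u‖) := by gcongr
  rcases (norm_nonneg (A u)).eq_or_lt with h0 | h0
  · rw [← h0]; positivity
  · refine le_of_mul_le_mul_right ?_ h0
    linarith

/-- Suboptimality of the primal point recovered from a dual point. -/
theorem primal_gap_le (hA : A.IsSymmetric) {F : E → ℝ} (hμ : 0 < μ) {c x : E}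
    (hX : ∀ z v, F (X z) + μ / 2 * ‖X z - c‖ ^ 2 + ⟪z, v - X z⟫ + μ / 2 * ‖v - X z‖ ^ 2
      ≤ F v + μ / 2 * ‖v - c‖ ^ 2) (hx : A x = 0) (y : E) :
    F (X (A y)) ≤ F x + μ / 2 * ‖x - c‖ ^ 2 + ⟪y, A (X (A y))⟫ := by
  have h := hX (A y) x
  rw [hA, map_sub, hx, zero_sub, inner_neg_right] at h
  have h1 : 0 ≤ μ / 2 * ‖X (A y) - c‖ ^ 2 := by positivity
  have h2 : 0 ≤ μ / 2 * ‖x - X (A y)‖ ^ 2 := by positivity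
  linarith

end Dual

/-- The iteration count that makes `(1 - s) ^ N` small, `s` being the inverse square root of the
condition number `κ`. -/
theorem contraction_pow_mul_le {s κ T : ℝ} {N : ℕ} (hs : 0 < s) (hs1 : s ≤ 1)
    (hsκ : s ^ 2 * κ = 1) (hκ : 0 < κ) (hT : 1 ≤ T) (hκT : κ ≤ 5 * T ^ 2)
    (hN : 60 * T * (1 + Real.log T) ≤ N) : (1 - s) ^ N * (128 * κ ^ 5) ≤ 1 := by
  have hT0 : 0 < T := by linarith
  have hlog : 0 ≤ Real.log T := Real.log_nonneg hT
  have hsT : 1 ≤ s * (3 * T) := by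
    by_contra! h
    have h1 : (s * (3 * T)) ^ 2 < 1 := by
      have : 0 ≤ s * (3 * T) := by positivity
      nlinarith
    have h2 : s ^ 2 * κ ≤ s ^ 2 * (5 * T ^ 2) := by gcongr
    nlinarith [mul_pos (pow_pos hs 2) (pow_pos hT0 2)]
  have hsN : 20 * (1 + Real.log T) ≤ N * s := by
    calc 20 * (1 + Real.log T) = 1 * (20 * (1 + Real.log T)) := by ring
      _ ≤ (s * (3 * T)) * (20 * (1 + Real.log T)) := by gcongr
      _ = (60 * T * (1 + Real.log T)) * s := by ring
      _ ≤ N * s := by gcongr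
  have h1 : (1 - s) ^ N ≤ Real.exp (-(20 * (1 + Real.log T))) := by
    calc (1 - s) ^ N ≤ Real.exp (-s) ^ N :=
          pow_le_pow_left₀ (sub_nonneg.2 hs1) (Real.one_sub_le_exp_neg s) N
      _ = Real.exp (-(N * s)) := by rw [← Real.exp_nat_mul]; congr 1; ring
      _ ≤ _ := by gcongr
  have h2 : Real.exp (20 * (1 + Real.log T)) = Real.exp 1 ^ 20 * T ^ 20 := by
    rw [← Real.exp_nat_mul, ← Real.exp_log (pow_pos hT0 20), ← Real.exp_add, Real.log_pow]
    congr 1; push_cast; ring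
  -- `128 · 5⁵ = 400000 ≤ 2²⁰` and `e ≥ 2`: the exponent 20 covers both the constant and `T ^ 10`.
  have h3 : 128 * κ ^ 5 ≤ Real.exp (20 * (1 + Real.log T)) := by
    calc 128 * κ ^ 5 ≤ 128 * (5 * T ^ 2) ^ 5 := by gcongr
      _ = 400000 * T ^ 10 := by ring
      _ ≤ 2 ^ 20 * T ^ 20 := by
        gcongr ?_ * ?_
        · norm_num
        · exact pow_le_pow_right₀ hT (by norm_num)
      _ ≤ Real.exp 1 ^ 20 * T ^ 20 := by
        gcongr
        linarith [Real.exp_one_gt_d9]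
      _ = _ := h2.symm
  calc (1 - s) ^ N * (128 * κ ^ 5)
      ≤ Real.exp (-(20 * (1 + Real.log T))) * Real.exp (20 * (1 + Real.log T)) := by gcongr
    _ = 1 := by rw [← Real.exp_add, neg_add_cancel, Real.exp_zero]

/-! ### Extreme eigenvalues of `AᵀA`, shortest dual solutions, attainment of the dual supremum. -/

section Spectral

variable {ι : Type} [Fintype ι]

theorem isHermitian_transpose_mul_self (A : Matrix ι ι ℝ) : (A.transpose * A).IsHermitian := by
  have := Matrix.isHermitian_conjTranspose_mul_self A
  rwa [Matrix.conjTranspose_eq_transpose_of_trivial] at this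

variable [DecidableEq ι]

theorem app_mul (A B : Matrix ι ι ℝ) (x : EuclideanSpace ℝ ι) :
    app (A * B) x = app A (app B x) := by
  simp [app, Matrix.toLpLin_apply]

theorem inner_app_left (A : Matrix ι ι ℝ) (x y : EuclideanSpace ℝ ι) :
    ⟪app A x, y⟫ = ⟪x, app A.transpose y⟫ := by
  simp [app, Matrix.toLpLin_apply, EuclideanSpace.inner_eq_star_dotProduct,
    Matrix.dotProduct_mulVec, Matrix.vecMul_transpose, dotProduct_comm]

theorem norm_app_sq (A : Matrix ι ι ℝ) (x : EuclideanSpace ℝ ι) :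
    ‖app A x‖ ^ 2 = ∑ i, (isHermitian_transpose_mul_self A).eigenvalues i *
      ⟪(isHermitian_transpose_mul_self A).eigenvectorBasis i, x⟫ ^ 2 := by
  set hB := isHermitian_transpose_mul_self A
  rw [← real_inner_self_eq_norm_sq, inner_app_left, ← app_mul,
    ← hB.eigenvectorBasis.sum_inner_mul_inner]
  refine Finset.sum_congr rfl fun i _ => ?_
  have h : app (A.transpose * A) (hB.eigenvectorBasis i)
      = hB.eigenvalues i • hB.eigenvectorBasis i := by
    have := hB.mulVec_eigenvectorBasis i
    simp only [app, Matrix.toLpLin_apply, this]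
    rfl
  have hs : (A.transpose * A).transpose = A.transpose * A := by simp [Matrix.transpose_mul]
  have h1 : ⟪hB.eigenvectorBasis i, app (A.transpose * A) x⟫
      = hB.eigenvalues i * ⟪hB.eigenvectorBasis i, x⟫ := by
    rw [← real_inner_smul_left, ← h, inner_app_left, hs]
  rw [h1, real_inner_comm]
  ring

theorem eigenvalues_transpose_mul_self_nonneg (A : Matrix ι ι ℝ) (i : ι) :
    0 ≤ (isHermitian_transpose_mul_self A).eigenvalues i := by
  have h := Matrix.posSemidef_conjTranspose_mul_self A
  simp only [Matrix.conjTranspose_eq_transpose_of_trivial] at h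
  exact h.eigenvalues_nonneg i

theorem finite_eigenvalues (B : Matrix ι ι ℝ) :
    {l : ℝ | ∃ v : ι → ℝ, v ≠ 0 ∧ Matrix.mulVec B v = l • v}.Finite := by
  refine (Module.End.finite_spectrum (Matrix.toLin' B)).subset ?_
  rintro l ⟨v, hv, h⟩
  refine Module.End.HasEigenvalue.mem_spectrum ?_
  exact Module.End.hasEigenvalue_of_hasEigenvector
    ⟨Module.End.mem_eigenspace_iff.2 (by simpa using h), hv⟩

theorem exists_eigenvector (A : Matrix ι ι ℝ) (i : ι) :
    ∃ v : ι → ℝ, v ≠ 0 ∧ Matrix.mulVec (A.transpose * A) v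
      = (isHermitian_transpose_mul_self A).eigenvalues i • v := by
  set hB := isHermitian_transpose_mul_self A
  refine ⟨hB.eigenvectorBasis i, fun h => ?_, hB.mulVec_eigenvectorBasis i⟩
  have h1 : hB.eigenvectorBasis i = 0 := by ext j; exact congrFun h j
  have h2 := hB.eigenvectorBasis.norm_eq_one i
  rw [h1, norm_zero] at h2
  exact zero_ne_one h2

theorem eigenvalues_le_sigmaMax (A : Matrix ι ι ℝ) (i : ι) :
    (isHermitian_transpose_mul_self A).eigenvalues i ≤ sigmaMax A :=
  le_csSup (finite_eigenvalues _).bddAbove (exists_eigenvector A i)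

theorem norm_app_sq_le (A : Matrix ι ι ℝ) (x : EuclideanSpace ℝ ι) :
    ‖app A x‖ ^ 2 ≤ sigmaMax A * ‖x‖ ^ 2 := by
  rw [norm_app_sq, ← (isHermitian_transpose_mul_self A).eigenvectorBasis.sum_sq_norm_inner_right x,
    Finset.mul_sum]
  refine Finset.sum_le_sum fun i _ => ?_
  rw [Real.norm_eq_abs, sq_abs]
  exact mul_le_mul_of_nonneg_right (eigenvalues_le_sigmaMax A i) (sq_nonneg _)

theorem finite_pos_eigenvalues (B : Matrix ι ι ℝ) :
    {l : ℝ | 0 < l ∧ ∃ v : ι → ℝ, v ≠ 0 ∧ Matrix.mulVec B v = l • v}.Finite :=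
  (finite_eigenvalues B).subset fun _ h => h.2

theorem sigmaMin_le_eigenvalues (A : Matrix ι ι ℝ) {i : ι}
    (hi : 0 < (isHermitian_transpose_mul_self A).eigenvalues i) :
    sigmaMin A ≤ (isHermitian_transpose_mul_self A).eigenvalues i :=
  csInf_le (finite_pos_eigenvalues _).bddBelow ⟨hi, exists_eigenvector A i⟩

/-- A nonzero value of `A` excludes the empty set, whose `sInf` is the default `0`; the infimum of a
finite nonempty set is attained, hence positive. -/
theorem sigmaMin_pos_and_le_sigmaMax {A : Matrix ι ι ℝ} {x : EuclideanSpace ℝ ι}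
    (hx : app A x ≠ 0) : 0 < sigmaMin A ∧ sigmaMin A ≤ sigmaMax A := by
  obtain ⟨i, hi⟩ : ∃ i, 0 < (isHermitian_transpose_mul_self A).eigenvalues i := by
    by_contra! h
    have h1 : ‖app A x‖ ^ 2 ≤ 0 := by
      rw [norm_app_sq]
      exact Finset.sum_nonpos fun i _ => mul_nonpos_of_nonpos_of_nonneg (h i) (sq_nonneg _)
    have := norm_pos_iff.2 hx
    nlinarith
  refine ⟨?_, (sigmaMin_le_eigenvalues A hi).trans (eigenvalues_le_sigmaMax A i)⟩
  have hne : {l : ℝ | 0 < l ∧ ∃ v : ι → ℝ, v ≠ 0 ∧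
      Matrix.mulVec (A.transpose * A) v = l • v}.Nonempty := ⟨_, hi, exists_eigenvector A i⟩
  exact (hne.csInf_mem (finite_pos_eigenvalues _)).1

/-- On the orthogonal complement of its kernel, `A` is bounded below by `√(sigmaMin A)`. -/
theorem sigmaMin_mul_le_norm_app_sq {A : Matrix ι ι ℝ} {y : EuclideanSpace ℝ ι}
    (hy : ∀ q, app A q = 0 → ⟪q, y⟫ = 0) : sigmaMin A * ‖y‖ ^ 2 ≤ ‖app A y‖ ^ 2 := by
  rw [norm_app_sq, ← (isHermitian_transpose_mul_self A).eigenvectorBasis.sum_sq_norm_inner_right y,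
    Finset.mul_sum]
  refine Finset.sum_le_sum fun i _ => ?_
  rw [Real.norm_eq_abs, sq_abs]
  rcases (eigenvalues_transpose_mul_self_nonneg A i).eq_or_lt with h0 | h0
  -- An eigenvector for the eigenvalue 0 lies in the kernel of `A`, so `y` has no component along
  -- it.
  · rw [hy, ← h0]
    · simp
    · have h1 : ‖app A ((isHermitian_transpose_mul_self A).eigenvectorBasis i)‖ ^ 2 = 0 := by
        rw [norm_app_sq]
        refine Finset.sum_eq_zero fun j _ => ?_
        rcases eq_or_ne j i with rfl | hji
        · rw [← h0, zero_mul]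
        · rw [(isHermitian_transpose_mul_self A).eigenvectorBasis.inner_eq_zero hji]; simp
      simpa using h1
  · exact mul_le_mul_of_nonneg_right (sigmaMin_le_eigenvalues A h0) (sq_nonneg _)

/-- A shortest minimizer of a function of `A y` is orthogonal to the kernel of `A`. -/
theorem inner_eq_zero_of_isMinNormMinimizer {A : Matrix ι ι ℝ} {h : EuclideanSpace ℝ ι → ℝ}
    (hA : ∀ y y', app A y = app A y' → h y = h y') {y : EuclideanSpace ℝ ι}
    (hy : IsMinNormMinimizer h y) {q : EuclideanSpace ℝ ι} (hq : app A q = 0) : ⟪q, y⟫ = 0 := by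
  rcases eq_or_ne q 0 with rfl | hq0
  · simp
  have hn : 0 < ‖q‖ ^ 2 := by have := norm_pos_iff.2 hq0; positivity
  set t := ⟪q, y⟫ / ‖q‖ ^ 2 with ht
  -- Removing from `y` its component along `q` keeps `A y`, yet shortens `y` unless that component
  -- is zero.
  have h1 : h (y - t • q) = h y := by
    apply hA
    simp only [app] at hq ⊢
    rw [map_sub, map_smul, hq, smul_zero, sub_zero]
  have h2 := hy.2 (y - t • q) (fun v hv => by
    have := hy.1 hv
    simpa only [Set.mem_ofPred_eq, h1] using this)
  have h3 : ‖y - t • q‖ ^ 2 = ‖y‖ ^ 2 - ⟪q, y⟫ ^ 2 / ‖q‖ ^ 2 := by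
    rw [norm_sub_sq_real, real_inner_smul_right, norm_smul, mul_pow, Real.norm_eq_abs, sq_abs,
      real_inner_comm, ht]
    field_simp
    ring
  have h4 := pow_le_pow_left₀ (norm_nonneg _) h2 2
  rw [h3] at h4
  have h5 : ⟪q, y⟫ ^ 2 / ‖q‖ ^ 2 ≤ 0 := by linarith
  rw [div_le_iff₀ hn, zero_mul] at h5
  exact pow_eq_zero_iff two_ne_zero |>.1 (le_antisymm h5 (sq_nonneg _))

theorem dualFun_eq {A : Matrix ι ι ℝ} {g : EuclideanSpace ℝ ι → ℝ} {y x : EuclideanSpace ℝ ι}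
    (hx : IsSubSol g (app A.transpose y) x) : dualFun A g y = ⟪app A.transpose y, x⟫ - g x := by
  have h : ∀ v, ⟪app A.transpose y, v⟫ - g v ≤ ⟪app A.transpose y, x⟫ - g x :=
    fun v => hx (Set.mem_univ v)
  exact le_antisymm (ciSup_le h) (le_ciSup (f := fun v => ⟪app A.transpose y, v⟫ - g v)
    ⟨_, Set.forall_mem_range.2 h⟩ x)

end Spectral

end DistOpt

namespace DistOpt

/-! ### The complexity bound for a symmetric constraint matrix. -/

section Generic

variable {ι : Type} [Fintype ι] [DecidableEq ι]

theorem isSymmetric_toEuclideanLin_of_transpose_eq {A : Matrix ι ι ℝ} (hA : A.transpose = A) :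
    (Matrix.toEuclideanLin A).IsSymmetric := by
  intro x y
  have := inner_app_left A x y
  rwa [hA] at this

/-- The dual fast gradient method for `min_{A x = 0} F x` with a symmetric matrix `A`. -/
theorem dual_fgm_isApproxOptimal {A : Matrix ι ι ℝ} (hA : A.transpose = A)
    {F : EuclideanSpace ℝ ι → ℝ} (hFconv : ConvexOn ℝ Set.univ F) {M : ℝ≥0}
    (hFlip : LipschitzWith M F) {c x : EuclideanSpace ℝ ι} (hc : IsSubSol F 0 c)
    (hx : IsClosestSol A F c x) (hxc : 0 < ‖x - c‖) {ε μ : ℝ} (hε : 0 < ε)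
    (hμ : μ = ε / ‖x - c‖ ^ 2) {u : EuclideanSpace ℝ ι}
    (hu : IsMinNormMinimizer (dualFun A (regularize F μ c)) u) {ν : ℝ} (hν : ν = ε / ‖u‖ ^ 2)
    {X : EuclideanSpace ℝ ι → EuclideanSpace ℝ ι}
    (hX : ∀ z, IsSubSol (regularize F μ c) z (X z))
    {L : ℝ} (hL : L = sigmaMax A / μ + ν)
    {T : ℝ} (hT : T = √((max (M : ℝ) (ε / ‖x - c‖)) ^ 2 * ‖x - c‖ ^ 2 / ε ^ 2 * chi A))
    {N : ℕ} (hN : 60 * T * (1 + Real.log T) ≤ N) :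
    0 < ‖u‖ ∧ IsApproxOptimal A F ε (ε / ‖u‖)
      (X (app A (fgm (fun y => app A (X (app A y)) + ν • y) L ((√L - √ν) / (√L + √ν)) N).1)) := by
  have hμ0 : 0 < μ := by rw [hμ]; positivity
  set B := Matrix.toEuclideanLin A with hB
  have happ : ∀ y, app A y = B y := fun _ => rfl
  have hsymm : B.IsSymmetric := isSymmetric_toEuclideanLin_of_transpose_eq hA
  have hgrow : ∀ z v, F (X z) + μ / 2 * ‖X z - c‖ ^ 2 + ⟪z, v - X z⟫ + μ / 2 * ‖v - X z‖ ^ 2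
      ≤ F v + μ / 2 * ‖v - c‖ ^ 2 := fun z v => quadratic_growth_of_isMaxOn hFconv (hX z) v
  have hcmin : ∀ v, F c ≤ F v := by
    intro v
    have := hc (Set.mem_univ v)
    simpa using this
  have hX0 : X 0 = c := by
    have h := hgrow 0 c
    have h1 := hcmin (X 0)
    rw [inner_zero_left, sub_self, norm_zero, norm_sub_rev c] at h
    have h2 : μ * ‖X 0 - c‖ ^ 2 ≤ 0 := by linarith
    have h3 : ‖X 0 - c‖ ^ 2 ≤ 0 := by
      by_contra! h4
      linarith [mul_pos hμ0 h4]
    exact sub_eq_zero.1 (norm_eq_zero.1 (pow_eq_zero_iff two_ne_zero |>.1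
      (le_antisymm h3 (sq_nonneg _))))
  -- A feasible `c` would itself be the closest solution, contradicting `0 < ‖x - c‖`. The same fact
  -- excludes `u = 0` below, as `X 0 = c`.
  have hAc : app A c ≠ 0 := by
    intro h
    have := hx.2 c ⟨h, fun v _ => hcmin v⟩
    rw [sub_self, norm_zero] at this
    linarith
  obtain ⟨hσ, hσΛ⟩ := sigmaMin_pos_and_le_sigmaMax hAc
  set Λ := sigmaMax A with hΛdef
  have hΛ0 : 0 < Λ := hσ.trans_le hσΛ
  have hΛ : ∀ y, ‖B y‖ ^ 2 ≤ Λ * ‖y‖ ^ 2 := norm_app_sq_le A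
  have hdual : ∀ y, dualFun A (regularize F μ c) y = dualValue B (regularize F μ c) X y := by
    intro y
    rw [dualFun_eq (hX _), hA]
    rfl
  have humin : ∀ y, dualValue B (regularize F μ c) X u ≤ dualValue B (regularize F μ c) X y := by
    intro y
    rw [← hdual, ← hdual]
    exact hu.1 (Set.mem_univ y)
  have hfeas : B (X (B u)) = 0 := map_eq_zero_of_dual_minimizer hsymm hμ0 hΛ0 hΛ hgrow humin
  have hu0 : 0 < ‖u‖ := by
    rw [norm_pos_iff]
    rintro rfl
    rw [map_zero, hX0] at hfeas
    exact hAc hfeas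
  refine ⟨hu0, ?_⟩
  have hν0 : 0 < ν := by rw [hν]; positivity
  -- size of the dual solution
  set K := max (M : ℝ) (ε / ‖x - c‖) with hK
  have hKε : ε / ‖x - c‖ ≤ K := le_max_right _ _
  have hK0 : 0 < K := lt_of_lt_of_le (by positivity) hKε
  have hBu : ‖B u‖ ≤ 2 * K := by
    have h := norm_map_dual_minimizer_le hsymm hFlip hμ0 hgrow hx.1.1 hx.1.2 hfeas
    have h1 : μ * ‖x - c‖ = ε / ‖x - c‖ := by rw [hμ]; field_simp
    have h2 : (M : ℝ) ≤ K := le_max_left _ _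
    linarith
  have hσu : sigmaMin A * ‖u‖ ^ 2 ≤ 4 * K ^ 2 := by
    have h := sigmaMin_mul_le_norm_app_sq (A := A) (y := u) fun q hq =>
      inner_eq_zero_of_isMinNormMinimizer (fun y y' h => by simp only [dualFun, hA, h]) hu hq
    have h1 : ‖app A u‖ ^ 2 ≤ (2 * K) ^ 2 := pow_le_pow_left₀ (norm_nonneg _) hBu 2
    linarith
  -- condition number
  have hL0 : 0 < L := by rw [hL]; positivity
  have hTsq : T ^ 2 = K ^ 2 * ‖x - c‖ ^ 2 / ε ^ 2 * (Λ / sigmaMin A) := by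
    rw [hT, Real.sq_sqrt, chi]
    unfold chi
    positivity
  have hT0 : 0 ≤ T := by rw [hT]; exact Real.sqrt_nonneg _
  -- The maximum with `ε/‖x - c‖` in `K` serves here: it forces `K ‖x - c‖ ≥ ε`, so `log T ≥ 0`.
  have hT1 : 1 ≤ T := by
    have h1 : 1 ≤ K ^ 2 * ‖x - c‖ ^ 2 / ε ^ 2 := by
      rw [le_div_iff₀ (by positivity), one_mul, ← mul_pow]
      exact pow_le_pow_left₀ hε.le ((div_le_iff₀ hxc).1 hKε) 2
    have h2 : 1 ≤ Λ / sigmaMin A := (one_le_div hσ).2 hσΛ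
    have h3 : 1 ≤ T ^ 2 := by rw [hTsq]; exact one_le_mul_of_one_le_of_one_le h1 h2
    by_contra! h
    nlinarith
  have hκT : L / ν ≤ 5 * T ^ 2 := by
    have h1 : L / ν = Λ * ‖x - c‖ ^ 2 / ε ^ 2 * ‖u‖ ^ 2 + 1 := by
      rw [hL, hμ, hν]; field_simp
    have h2 : Λ * ‖x - c‖ ^ 2 / ε ^ 2 * ‖u‖ ^ 2 ≤ 4 * T ^ 2 := by
      have : ‖u‖ ^ 2 ≤ 4 * K ^ 2 / sigmaMin A := by
        rw [le_div_iff₀ hσ]; linarith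
      calc _ ≤ Λ * ‖x - c‖ ^ 2 / ε ^ 2 * (4 * K ^ 2 / sigmaMin A) := by gcongr
        _ = _ := by rw [hTsq]; ring
    have h3 : 1 ≤ T ^ 2 := one_le_pow₀ hT1
    linarith
  set s := √ν / √L with hs
  have hs0 : 0 < s := by positivity
  have hs2 : s ^ 2 = ν / L := by rw [hs, div_pow, Real.sq_sqrt hν0.le, Real.sq_sqrt hL0.le]
  have hνL : ν ≤ L := by rw [hL]; exact le_add_of_nonneg_left (by positivity)
  have hs1 : s ≤ 1 := by
    rw [hs, div_le_one (by positivity)]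
    exact Real.sqrt_le_sqrt hνL
  have hsκ : s ^ 2 * (L / ν) = 1 := by rw [hs2]; field_simp
  have hβ : (√L - √ν) / (√L + √ν) = (1 - s) / (1 + s) := by
    have : 0 < √L := by positivity
    rw [hs]; field_simp
  have hpow := contraction_pow_mul_le hs0 hs1 hsκ (by positivity) hT1 hκT hN
  obtain ⟨h1, h2⟩ := fgm_regularized_gradient (g := fun y => B (X (B y)))
    (by positivity : 0 < Λ / μ) hν0 (dualValue_lower hsymm hμ0 hgrow)
    (dualValue_upper hsymm hμ0 hΛ hgrow) (dual_gradient_lipschitz (H := regularize F μ c) hμ0 hΛ0.le hΛ hgrow) humin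
    hs0 hs1 hsκ (by rw [← hL]; field_simp) N hpow
  rw [← hL, ← hβ] at h1 h2
  have hνu : ν * ‖u‖ ^ 2 = ε := by rw [hν]; field_simp
  constructor
  · intro v hv
    have h3 := primal_gap_le hsymm hμ0 hgrow hx.1.1
      (fgm (fun y => B (X (B y)) + ν • y) L ((√L - √ν) / (√L + √ν)) N).1
    have h4 : μ / 2 * ‖x - c‖ ^ 2 = ε / 2 := by rw [hμ]; field_simp
    have h5 := hx.1.2 v hv
    rw [hνu] at h2
    simp only [happ]
    linarith
  · have h3 : ν * ‖u‖ = ε / ‖u‖ := by rw [hν]; field_simp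
    rw [h3] at h1
    exact h1

end Generic

/-! ### Splitting over the agents, and the distributed iteration as the dual method. -/

section Blocks

variable {m n : ℕ}

theorem block_stack (u : Fin m → Local n) (i : Fin m) : block (stack u) i = u i := rfl

theorem block_apply (x : Stacked m n) (i : Fin m) (k : Fin n) : block x i k = x (i, k) := rfl

theorem stack_apply (u : Fin m → Local n) (i : Fin m) (k : Fin n) : stack u (i, k) = u i k := rfl

theorem inner_eq_sum_block (x y : Stacked m n) : ⟪x, y⟫ = ∑ i, ⟪block x i, block y i⟫ := by
  simp only [PiLp.inner_apply, block_apply, Fintype.sum_prod_type]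

theorem norm_sq_eq_sum_block (x : Stacked m n) : ‖x‖ ^ 2 = ∑ i, ‖block x i‖ ^ 2 := by
  simp only [← real_inner_self_eq_norm_sq, inner_eq_sum_block]

theorem convexOn_total {f : Fin m → Local n → ℝ} (hf : ∀ i, ConvexOn ℝ Set.univ (f i)) :
    ConvexOn ℝ Set.univ (total f) := by
  refine ⟨convex_univ, fun x _ y _ a b ha hb hab => ?_⟩
  simp only [total, Finset.smul_sum, ← Finset.sum_add_distrib]
  exact Finset.sum_le_sum fun i _ => 
    (hf i).2 (Set.mem_univ (block x i)) (Set.mem_univ (block y i)) ha hb hab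

theorem regularize_total (f : Fin m → Local n → ℝ) (μ : ℝ) (c x : Stacked m n) :
    regularize (total f) μ c x = ∑ i, regularize (f i) μ (block c i) (block x i) := by
  simp only [regularize, total, Finset.sum_add_distrib, ← Finset.mul_sum, norm_sq_eq_sum_block]
  rfl

/-- Dual-friendliness: the dual subproblem splits into the subproblems of the agents. -/
theorem isSubSol_stack {f : Fin m → Local n → ℝ} {μ : ℝ} {c z : Stacked m n}
    {v : Fin m → Local n}
    (hv : ∀ j, IsSubSol (regularize (f j) μ (block c j)) (block z j) (v j)) :
    IsSubSol (regularize (total f) μ c) z (stack v) := by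
  intro x _
  simp only [Set.mem_ofPred_eq, regularize_total, inner_eq_sum_block, ← Finset.sum_sub_distrib,
    block_stack]
  exact Finset.sum_le_sum fun i _ => hv i (Set.mem_univ _)

variable (G : SimpleGraph (Fin m)) [DecidableRel G.Adj]

open scoped MatrixOrder in
theorem sqrtComm_mul_self : sqrtComm G n * sqrtComm G n = commMatrix G n := by
  refine CFC.sqrt_mul_sqrt_self _ (Matrix.nonneg_iff_posSemidef.2 ?_)
  exact (SimpleGraph.posSemidef_lapMatrix ℝ G).kronecker Matrix.PosSemidef.one

open scoped MatrixOrder in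
theorem transpose_sqrtComm : (sqrtComm G n).transpose = sqrtComm G n := by
  have h := (Matrix.nonneg_iff_posSemidef.1 (CFC.sqrt_nonneg (commMatrix G n))).1
  rwa [Matrix.IsHermitian, Matrix.conjTranspose_eq_transpose_of_trivial] at h

theorem app_commMatrix (x : Stacked m n) :
    app (commMatrix G n) x = stack fun i => ∑ j, G.lapMatrix ℝ i j • block x j := by
  ext ⟨i, k⟩
  simp [app, Matrix.toLpLin_apply, Matrix.mulVec, dotProduct, commMatrix, Fintype.sum_prod_type,
    stack_apply, block_apply, Matrix.one_apply]

/-- The distributed method is the fast gradient method for the regularized dual function, in the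
variable `z = √W y`. -/
theorem stack_distFGM (xs : Fin m → Local n → Local n) (L ν : ℝ) (k : ℕ) :
    let X : Stacked m n → Stacked m n := fun z => stack fun j => xs j (block z j)
    let it := fgm (fun y => app (sqrtComm G n) (X (app (sqrtComm G n) y)) + ν • y) L
      ((√L - √ν) / (√L + √ν)) k
    stack (distFGM G xs L ν k).1 = app (sqrtComm G n) it.1 ∧
      stack (distFGM G xs L ν k).2 = app (sqrtComm G n) it.2 := by
  intro X
  induction k with
  | zero =>
    have h0 : app (sqrtComm G n) 0 = 0 := map_zero (Matrix.toEuclideanLin (sqrtComm G n))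
    simp only [fgm_zero, h0]
    exact ⟨rfl, rfl⟩
  | succ k ih =>
    simp only at ih ⊢
    obtain ⟨ih1, ih2⟩ := ih
    set g := fun y => app (sqrtComm G n) (X (app (sqrtComm G n) y)) + ν • y with hg
    set β := (√L - √ν) / (√L + √ν) with hβ
    have h1 : stack (distFGM G xs L ν (k + 1)).1 = app (sqrtComm G n) (fgm g L β (k + 1)).1 := by
      -- Applying `√W` to the dual step merges the two square roots into `W`, so only neighbours
      -- communicate.
      have e : app (sqrtComm G n) (fgm g L β (k + 1)).1
          = app (sqrtComm G n) (fgm g L β k).2 - (1 / L) • (app (commMatrix G n)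
            (X (app (sqrtComm G n) (fgm g L β k).2))
              + ν • app (sqrtComm G n) (fgm g L β k).2) := by
        rw [fgm_succ_fst, hg, ← sqrtComm_mul_self, app_mul]
        simp only [app, map_sub, map_smul, map_add]
      rw [e, ← ih2, app_commMatrix]
      rfl
    refine ⟨h1, ?_⟩
    have e : app (sqrtComm G n) (fgm g L β (k + 1)).2
        = app (sqrtComm G n) (fgm g L β (k + 1)).1
          + β • (app (sqrtComm G n) (fgm g L β (k + 1)).1
            - app (sqrtComm G n) (fgm g L β k).1) := by
      rw [fgm_succ_snd]
      simp only [app, map_sub, map_smul, map_add]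
    rw [e, ← h1, ← ih1]
    rfl

end Blocks

end DistOpt
theorem theorem4 :
    ∃ C : ℝ, 0 < C ∧
      ∀ (m n : ℕ) (G : SimpleGraph (Fin m)) [DecidableRel G.Adj] (_ : G.Connected)
        (f : Fin m → DistOpt.Local n → ℝ) (_ : ∀ i, ConvexOn ℝ Set.univ (f i))
        (M : ℝ≥0) (_ : LipschitzWith M (DistOpt.total f))
        -- `c = x^*(z₀)` with `z₀ = 0`, and the solution `x^*` closest to it
        (c xopt : DistOpt.Stacked m n) (_ : DistOpt.IsSubSol (DistOpt.total f) 0 c)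
        (_ : DistOpt.IsClosestSol (DistOpt.sqrtComm G n) (DistOpt.total f) c xopt)
        (Rx : ℝ) (_ : Rx = ‖xopt - c‖) (_ : 0 < Rx)
        (ε : ℝ) (_ : 0 < ε) (μ : ℝ) (_ : μ = ε / Rx ^ 2)
        -- the smallest-norm solution of the dual of the regularized problem
        (ystar : DistOpt.Stacked m n)
        (_ : DistOpt.IsMinNormMinimizer
          (DistOpt.dualFun (DistOpt.sqrtComm G n)
            (DistOpt.regularize (DistOpt.total f) μ c)) ystar)
        (R : ℝ) (_ : R = ‖ystar‖) (ν : ℝ) (_ : ν = ε / R ^ 2)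
        -- the explicit solutions of the dual subproblem, agent by agent
        (xs : Fin m → DistOpt.Local n → DistOpt.Local n)
        (_ : ∀ j w, DistOpt.IsSubSol
          (DistOpt.regularize (f j) μ (DistOpt.block c j)) w (xs j w))
        (L : ℝ) (_ : L = DistOpt.sigmaMax (DistOpt.sqrtComm G n) / μ + ν)
        (T : ℝ) (_ : T = √((max (M : ℝ) (ε / Rx)) ^ 2 * Rx ^ 2 / ε ^ 2 *
          DistOpt.chi (DistOpt.sqrtComm G n)))
        (N : ℕ) (_ : C * T * (1 + Real.log T) ≤ N),
        0 < R ∧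
        DistOpt.IsApproxOptimal (DistOpt.sqrtComm G n) (DistOpt.total f) ε (ε / R)
          (DistOpt.stack fun j => xs j ((DistOpt.distFGM G xs L ν N).1 j)) := by
  -- `60 = 3 · 20`: `s ≥ 1/(3T)`, and `N s ≥ 20 (1 + log T)` is needed.
  refine ⟨60, by norm_num, ?_⟩
  intro m n G _ _ f hf M hM c xopt hc hxopt Rx hRx hRx0 ε hε μ hμ ystar hy R hR ν hν xs hxs L hL T hT
    N hN
  subst hRx hR
  have h := DistOpt.dual_fgm_isApproxOptimal (DistOpt.transpose_sqrtComm G)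
    (DistOpt.convexOn_total hf) hM hc hxopt hRx0 hε hμ hy hν
    (X := fun z => DistOpt.stack fun j => xs j (DistOpt.block z j))
    (fun z => DistOpt.isSubSol_stack fun j => hxs j _) hL hT hN
  refine ⟨h.1, ?_⟩
  rw [← (DistOpt.stack_distFGM G xs L ν N).1] at h
  exact h.2
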